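/- For a positive integer $d$ let $\phi$ denote Euler's totient, let $\Phi_d(x)$ be the $d$th cyclotomic polynomial, let $\mathbb{T}$ be the unit circle in $\mathbb{C}$, and define the Laurent polynomial function $g_d:\mathbb{T}^{\phi(d)}\to\mathbb{C}$ by \[ g_d(z_1,\ldots,z_{\phi(d)})=\sum_{k=0}^{d-1}\ \prod_{j=0}^{\phi(d)-1} z_{j+1}^{c_{jk}}, \] where the integers $c_{jk}$ are given by $x^k\equiv\sum_{j=0}^{\phi(d)-1}c_{jk}x^j \pmod{\Phi_d(x)}$. For an odd prime $r$ let $H_r\subset\mathbb{C}$ be the compact region bounded by the hypocycloid with $r$ cusps parametrized by $\theta\mapsto (r-1)e(\theta)+e((1-r)\theta)$, $\theta\in\mathbb{R}$, where $e(\theta)=\exp(2\pi i\theta)$; that is, $H_r$ consists of this curve together with the bounded connected components of its complement in $\mathbb{C}$. Then for every odd prime $r$ and every integer $b\geq 1$, the image of $g_{r^b}$ is the Minkowski sum of $r^{b-1}$ copies of $H_r$: \[ g_{r^b}\bigl(\mathbb{T}^{\phi(r^b)}\bigr)=\sum_{j=1}^{r^{b-1}}H_r=\bigl\{h_1+\cdots+h_{r^{b-1}}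 : h_1,\ldots,h_{r^{b-1}}\in H_r\bigr\}. \] -/

import Mathlib

open scoped Pointwise

namespace CyclicSupercharacter

/-- `e θ = exp (2 π i θ)` for real `θ`. -/
noncomputable def e (θ : ℝ) : ℂ := Complex.exp (2 * Real.pi * Complex.I * θ)

/-- The integers `c_{jk}` with `x ^ k ≡ ∑_{j < φ(d)} c_{jk} x ^ j` modulo `Φ_d(x)`: the coefficients
of the remainder of `x ^ k` on division by the (monic) cyclotomic polynomial `Φ_d`. -/
noncomputable def c (d j k : ℕ) : ℤ :=
  ((Polynomial.X ^ k : Polynomial ℤ) %ₘ Polynomial.cyclotomic d ℤ).coeff j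

/-- The defining relation of the integers `c_{jk}`. -/
theorem c_spec (d k : ℕ) :
    Polynomial.cyclotomic d ℤ ∣ (Polynomial.X ^ k : Polynomial ℤ) -
      ∑ j ∈ Finset.range (Nat.totient d), Polynomial.C (c d j k) * Polynomial.X ^ j := by
  have hm : (Polynomial.cyclotomic d ℤ).Monic := Polynomial.cyclotomic.monic d ℤ
  have hdeg : ((Polynomial.X ^ k : Polynomial ℤ) %ₘ Polynomial.cyclotomic d ℤ).degree <
      (Nat.totient d : WithBot ℕ) := by
    rw [← Polynomial.degree_cyclotomic d ℤ]
    exact Polynomial.degree_modByMonic_lt _ hm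
  have hsum : ∑ j ∈ Finset.range (Nat.totient d),
      Polynomial.C (c d j k) * Polynomial.X ^ j =
      (Polynomial.X ^ k : Polynomial ℤ) %ₘ Polynomial.cyclotomic d ℤ := by
    ext n
    simp only [Polynomial.finsetSum_coeff, Polynomial.coeff_C_mul_X_pow, c]
    rw [Finset.sum_ite_eq]
    split_ifs with h
    · rfl
    · rw [Finset.mem_range, not_lt] at h
      exact (Polynomial.coeff_eq_zero_of_degree_lt
        (hdeg.trans_le (by exact_mod_cast h))).symm
  rw [hsum]
  exact ⟨_, sub_eq_of_eq_add' (Polynomial.modByMonic_add_div (Polynomial.X ^ k)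
    (Polynomial.cyclotomic d ℤ)).symm⟩

/-- The Laurent polynomial function `g_d : 𝕋 ^ φ(d) → ℂ`,
`g_d(z) = ∑_{k < d} ∏_{j < φ(d)} z_{j+1} ^ c_{jk}`; the coordinates `z_1, …, z_{φ(d)}` are
numbered here from `0`. -/
noncomputable def g (d : ℕ) (z : Fin (Nat.totient d) → Circle) : ℂ :=
  ∑ k ∈ Finset.range d, ∏ j : Fin (Nat.totient d), (z j : ℂ) ^ c d j k

/-- The hypocycloid traced by a point of a circle of radius `1` rolling inside a circle of
radius `r`, centred at the origin and with a cusp at `r`. -/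
noncomputable def hypocycloid (r : ℕ) : Set ℂ :=
  Set.range fun θ : ℝ => ((r : ℂ) - 1) * e θ + e ((1 - (r : ℝ)) * θ)

/-- The compact region bounded by the hypocycloid: the curve together with the bounded connected
components of its complement in the plane. -/
noncomputable def H (r : ℕ) : Set ℂ :=
  hypocycloid r ∪
    {z | z ∉ hypocycloid r ∧ Bornology.IsBounded (connectedComponentIn (hypocycloid r)ᶜ z)}

end CyclicSupercharacter

/-!
The region `H r` is identified with the set of all sums of `r` unit complex numbers with product
`1` (`H_eq_unitSums`, for odd `r ≥ 3`). Since `Φ_{r^b}(x) = ∑_{q < r} x ^ (q r^{b-1})`, the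
variables of `g_{r^b}` fall into `r^{b-1}` groups of `r - 1` according to the residue of the index
modulo `r^{b-1}`, and `g_{r^b}` is the sum over the groups of
`z_1 + ⋯ + z_{r-1} + (z_1 ⋯ z_{r-1})⁻¹`. Hence its image is the Minkowski sum of `r^{b-1}` copies
of that set (`range_g_prime_pow`).

`H r` lies in the set of sums (`H_subset_unitSums`): it suffices that every segment from the origin
to a point `(r - 1) α + α^{1-r}` of the curve consists of such sums. As `r - 1` is even, splitting
the `r - 1` equal summands into pairs shows that `c β + β^{1-r}` is a sum of the required kind for
all unit `β` and real `c` with `|c| ≤ r - 1`, and a point of the segment is brought into this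
form by choosing `β` with the intermediate value theorem (`exists_angle`).

Conversely (`unitSums_subset_H`), the set of sums is compact, and each of its points off the curve
is an interior point (`mem_hypocycloid_or_mem_nhds`): if two disjoint pairs of summands consist of
distinct numbers, moving both pairs covers a neighbourhood; otherwise `r - 1` summands coincide,
which gives a point of the curve, or `r = 3` and the three summands are distinct, in which case the
derivative of the parametrization is onto. So a component of the complement of the curve that meets
the set of sums is contained in it, and is therefore bounded.
-/

namespace CyclicSupercharacter

/-! ### Sums of unit numbers with product one -/

/-- The sums of `n` unit complex numbers with product `1`, that is, the traces of the matrices in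
`SU(n)`. Multisets make it immediate to single out and replace individual summands. -/
def unitSums (n : ℕ) : Set ℂ :=
  {w | ∃ s : Multiset Circle, s.card = n ∧ s.prod = 1 ∧ (s.map Circle.coeHom).sum = w}

/-! ### Trigonometric inequalities -/

theorem sin_nat_mul_le (n : ℕ) {x : ℝ} (h0 : 0 ≤ x) (hpi : x ≤ Real.pi) :
    |Real.sin (n * x)| ≤ n * Real.sin x := by
  have hs := Real.sin_nonneg_of_nonneg_of_le_pi h0 hpi
  induction n with
  | zero => simp
  | succ n ih =>
    have h : ((n + 1 : ℕ) : ℝ) * x = n * x + x := by push_cast; ring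
    rw [h, Real.sin_add]
    calc |Real.sin (n * x) * Real.cos x + Real.cos (n * x) * Real.sin x|
        ≤ |Real.sin (n * x)| * |Real.cos x| + |Real.cos (n * x)| * |Real.sin x| := by
          rw [← abs_mul, ← abs_mul]; exact abs_add_le _ _
      _ ≤ n * Real.sin x * 1 + 1 * Real.sin x := by
          rw [abs_of_nonneg hs]
          gcongr
          · exact Real.abs_cos_le_one _
          · exact Real.abs_cos_le_one _
      _ = _ := by push_cast; ring

/-- As `u` increases from `0`, the difference
`sin (u + (r - 1) t) - sin (u + t) = 2 sin ((r - 2) t / 2) cos (u + r t / 2)` decreases. -/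
theorem sin_sub_sin_le (r : ℕ) (hr : 2 ≤ r) {u t : ℝ} (hu : 0 ≤ u) (ht : 0 ≤ t)
    (hut : u + r * t ≤ Real.pi) :
    Real.sin (u + (r - 1) * t) - Real.sin (u + t) ≤ Real.sin ((r - 1) * t) - Real.sin t := by
  have hr' : (2 : ℝ) ≤ r := by exact_mod_cast hr
  have hrt : 0 ≤ (r - 2) * t := mul_nonneg (by linarith) ht
  have h1 : 0 ≤ Real.sin ((r - 2) * t / 2) :=
    Real.sin_nonneg_of_nonneg_of_le_pi (by linarith) (by nlinarith [Real.pi_pos])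
  have h2 : Real.cos (u + r * t / 2) ≤ Real.cos (r * t / 2) :=
    Real.cos_le_cos_of_nonneg_of_le_pi (by positivity) (by nlinarith) (by linarith)
  rw [Real.sin_sub_sin, Real.sin_sub_sin]
  have e1 : (u + (r - 1) * t - (u + t)) / 2 = (r - 2) * t / 2 := by ring
  have e2 : ((r - 1) * t - t) / 2 = (r - 2) * t / 2 := by ring
  have e3 : (u + (r - 1) * t + (u + t)) / 2 = u + r * t / 2 := by ring
  have e4 : ((r - 1) * t + t) / 2 = r * t / 2 := by ring
  rw [e1, e2, e3, e4]
  exact mul_le_mul_of_nonneg_left h2 (by positivity)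

/-- The point `s ((r - 1) + exp (-i u))`, turned by the angle `-t`, has the form
`c + exp (-i (u + r t))` with `c` real and `|c| ≤ r - 1`. The first equation says that `c` is real,
the second bounds it. -/
theorem exists_angle (r : ℕ) (hr : 3 ≤ r) {u s : ℝ} (hu : 0 ≤ u) (hu' : u ≤ Real.pi)
    (hs : 0 ≤ s) (hs' : s ≤ 1) :
    ∃ t : ℝ, s * ((r - 1) * Real.sin t + Real.sin (u + t)) = Real.sin (u + r * t) ∧
      |s * ((r - 1) * Real.cos t + Real.cos (u + t)) - Real.cos (u + r * t)| ≤ r - 1 := by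
  have hr' : (3 : ℝ) ≤ r := by exact_mod_cast hr
  -- the angle is sought in `[0, (π - u) / r]`, where `sin t`, `sin (u + t)` are nonnegative
  have hend : u + r * ((Real.pi - u) / r) = Real.pi := by field_simp; ring
  have hend0 : 0 ≤ (Real.pi - u) / r := div_nonneg (by linarith) (by linarith)
  have hrange : ∀ t, 0 ≤ t → t ≤ (Real.pi - u) / r → u + r * t ≤ Real.pi := by
    intro t _ ht
    rw [← hend]; gcongr
  have hD : ∀ t, 0 ≤ t → u + r * t ≤ Real.pi → 0 ≤ Real.sin t ∧ 0 ≤ Real.sin (u + t) := by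
    intro t ht htu
    exact ⟨Real.sin_nonneg_of_nonneg_of_le_pi ht (by nlinarith),
      Real.sin_nonneg_of_nonneg_of_le_pi (by linarith) (by nlinarith)⟩
  obtain ⟨t, ⟨ht0, ht1⟩, hF⟩ := intermediate_value_Icc hend0
    (f := fun t => s * ((r - 1) * Real.sin t + Real.sin (u + t)) - Real.sin (u + r * t))
    (by fun_prop)
    (show (0 : ℝ) ∈ _ by
      constructor
      · have := Real.sin_nonneg_of_nonneg_of_le_pi hu hu'
        simp only [Real.sin_zero, add_zero, mul_zero, zero_add]
        nlinarith
      · obtain ⟨h1, h2⟩ := hD _ hend0 hend.le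
        simp only [hend, Real.sin_pi, sub_zero]
        exact mul_nonneg hs (add_nonneg (mul_nonneg (by linarith) h1) h2))
  have htu := hrange t ht0 ht1
  obtain ⟨hA, hB⟩ := hD t ht0 htu
  have hF' : s * ((r - 1) * Real.sin t + Real.sin (u + t)) = Real.sin (u + r * t) := by
    simpa [sub_eq_zero] using hF
  refine ⟨t, hF', abs_le.2 ⟨?_, ?_⟩⟩
  · have hc : 0 ≤ Real.cos t :=
      Real.cos_nonneg_of_neg_pi_div_two_le_of_le (by linarith [Real.pi_pos]) (by nlinarith)
    have h1 := Real.neg_one_le_cos (u + t)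
    have h2 := Real.cos_le_one (u + r * t)
    have h3 : 0 ≤ s * ((r - 1) * Real.cos t) := mul_nonneg hs (mul_nonneg (by linarith) hc)
    nlinarith
  · rcases (add_nonneg (mul_nonneg (by linarith : (0 : ℝ) ≤ r - 1) hA) hB).eq_or_lt with h0 | hpos
    · -- here `t = 0`, and the first equation does not determine `s`
      have hst : Real.sin t = 0 := by nlinarith
      have ht : t = 0 := by
        by_contra hne
        exact (Real.sin_pos_of_pos_of_lt_pi (lt_of_le_of_ne ht0 (Ne.symm hne))
          (by nlinarith [Real.pi_pos])).ne' hst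
      subst ht
      have := Real.neg_one_le_cos u
      have := Real.cos_le_one u
      simp only [Real.cos_zero, add_zero, mul_zero, mul_one]
      nlinarith [mul_nonneg (by linarith : (0 : ℝ) ≤ 1 - s)
        (by linarith : (0 : ℝ) ≤ r - 1 + Real.cos u)]
    · -- multiplied by the positive factor, the bound no longer involves `s`
      refine le_of_mul_le_mul_right ?_ hpos
      have e1 : Real.sin (u + (r - 1) * t) = Real.sin (u + r * t) * Real.cos t
          - Real.cos (u + r * t) * Real.sin t := by
        rw [← Real.sin_sub]; congr 1; ring
      have e2 : Real.sin ((r - 1) * t) = Real.sin (u + r * t) * Real.cos (u + t)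
          - Real.cos (u + r * t) * Real.sin (u + t) := by
        rw [← Real.sin_sub]; congr 1; ring
      have h1 := sin_sub_sin_le r (by omega) hu ht0 htu
      have h2 : Real.sin ((r - 1) * t) ≤ (r - 1) * Real.sin t := by
        have := (le_abs_self _).trans
          (sin_nat_mul_le (r - 1) ht0 (by nlinarith : t ≤ Real.pi))
        rwa [Nat.cast_sub (by omega), Nat.cast_one] at this
      have h3 : (s * ((r - 1) * Real.cos t + Real.cos (u + t)) - Real.cos (u + r * t)) *
          ((r - 1) * Real.sin t + Real.sin (u + t)) =
          (r - 1) * Real.sin (u + (r - 1) * t) + Real.sin ((r - 1) * t) := by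
        rw [e1, e2, ← hF']; ring
      rw [h3]
      nlinarith [mul_le_mul_of_nonneg_left h1 (by linarith : (0 : ℝ) ≤ r - 1)]

/-- The generated `Circle.coeHom_apply` states this with a coercion that `simp` cannot match. -/
theorem coeHom_eq (z : Circle) : Circle.coeHom z = (z : ℂ) := rfl

/-! ### The hypocycloid and its interior consist of sums of unit numbers -/

theorem e_eq_circleExp (θ : ℝ) : e θ = Circle.exp (2 * Real.pi * θ) := by
  rw [e, Circle.coe_exp]; congr 1; push_cast; ring

/-- The hypocycloid with `n + 1` cusps is the set of `n α + α ^ (-n)`, i.e. of the sums of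
`n + 1` unit numbers with product `1` of which `n` are equal. -/
theorem mem_hypocycloid_iff {n : ℕ} {w : ℂ} :
    w ∈ hypocycloid (n + 1) ↔ ∃ α : Circle, (n : ℂ) * α + ((α : ℂ) ^ n)⁻¹ = w := by
  have key : ∀ θ : ℝ, (((n + 1 : ℕ) : ℂ) - 1) * e θ + e ((1 - ((n + 1 : ℕ) : ℝ)) * θ) =
      n * (Circle.exp (2 * Real.pi * θ) : ℂ) + ((Circle.exp (2 * Real.pi * θ) : ℂ) ^ n)⁻¹ := by
    intro θ
    have h : 2 * Real.pi * ((1 - ((n + 1 : ℕ) : ℝ)) * θ) = -(n * (2 * Real.pi * θ)) := by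
      push_cast; ring
    rw [e_eq_circleExp, e_eq_circleExp, h, Circle.exp_neg, Circle.coe_inv, Circle.exp_natCast_mul,
      Circle.coe_pow]
    push_cast; ring
  constructor
  · rintro ⟨θ, rfl⟩
    exact ⟨_, (key θ).symm⟩
  · rintro ⟨α, rfl⟩
    refine ⟨Complex.arg α / (2 * Real.pi), (key _).trans ?_⟩
    rw [mul_div_cancel₀ _ (by positivity), Circle.exp_arg]

theorem exists_circle_pair (u : Circle) {c : ℝ} (hc : |c| ≤ 2) :
    ∃ a b : Circle, a * b = u ^ 2 ∧ (a : ℂ) + b = c * u := by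
  obtain ⟨h1, h2⟩ := abs_le.1 hc
  have hcos : Real.cos (Real.arccos (c / 2)) = c / 2 :=
    Real.cos_arccos (by linarith) (by linarith)
  set y := Real.arccos (c / 2)
  refine ⟨u * Circle.exp y, u * Circle.exp (-y), ?_, ?_⟩
  · rw [Circle.exp_neg, mul_mul_mul_comm, mul_inv_cancel, mul_one, sq]
  · have h : (Circle.exp y : ℂ) + Circle.exp (-y) = (c : ℂ) := by
      rw [Circle.coe_exp, Circle.coe_exp, Complex.ofReal_neg, ← Complex.two_cos,
        ← Complex.ofReal_cos, hcos]
      push_cast; ring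
    rw [Circle.coe_mul, Circle.coe_mul, ← mul_add, h, mul_comm]

/-- Replacing `2 n` summands `α` by `n` pairs with product `α ^ 2` keeps the product and changes
`2 n α` into any `c α` with `|c| ≤ 2 n`. -/
theorem mul_add_inv_pow_mem_unitSums {n : ℕ} (hn : n ≠ 0) (α : Circle) {c : ℝ}
    (hc : |c| ≤ 2 * n) :
    (c : ℂ) * α + ((α : ℂ) ^ (2 * n))⁻¹ ∈ unitSums (2 * n + 1) := by
  have hn' : (0 : ℝ) < n := by positivity
  obtain ⟨a, b, hab, hsum⟩ := exists_circle_pair α (c := c / n)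
    (by rw [abs_div, abs_of_pos hn', div_le_iff₀ hn']; exact hc)
  refine ⟨(α ^ (2 * n))⁻¹ ::ₘ (Multiset.replicate n a + Multiset.replicate n b), ?_, ?_, ?_⟩
  · simp; ring
  · simp only [Multiset.prod_cons, Multiset.prod_add, Multiset.prod_replicate]
    rw [← mul_pow, hab, ← pow_mul, inv_mul_cancel]
  · simp only [Multiset.map_cons, Multiset.map_add, Multiset.map_replicate, Multiset.sum_cons,
      Multiset.sum_add, Multiset.sum_replicate, coeHom_eq, Circle.coe_inv, Circle.coe_pow,
      nsmul_eq_mul]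
    rw [← mul_add, hsum]
    push_cast; field_simp; ring

theorem conj_mem_unitSums {n : ℕ} {w : ℂ} (hw : w ∈ unitSums n) :
    starRingEnd ℂ w ∈ unitSums n := by
  obtain ⟨s, hs, hp, rfl⟩ := hw
  refine ⟨s.map (·⁻¹), by simpa using hs, ?_, ?_⟩
  · rw [Multiset.prod_map_inv, Multiset.map_id', hp, inv_one]
  · rw [map_multiset_sum, Multiset.map_map, Multiset.map_map]
    simp only [Function.comp_def, coeHom_eq, Circle.coe_inv_eq_conj]

/-- The segment from the origin to any point of the hypocycloid consists of sums of `2 n + 1`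
unit numbers with product `1`. -/
theorem smul_curve_mem_unitSums {n : ℕ} (hn : n ≠ 0) (α : Circle) {s : ℝ} (hs : 0 ≤ s)
    (hs' : s ≤ 1) :
    (s : ℂ) * ((2 * n : ℕ) * α + ((α : ℂ) ^ (2 * n))⁻¹) ∈ unitSums (2 * n + 1) := by
  -- complex conjugation reduces to `α ^ (2 n + 1)` in the closed upper half-plane
  wlog him : 0 ≤ ((α ^ (2 * n + 1) : Circle) : ℂ).im generalizing α
  · have h := conj_mem_unitSums (this α⁻¹ (by
      rw [inv_pow, Circle.coe_inv_eq_conj, Complex.conj_im]; linarith))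
    simpa only [map_mul, map_add, Complex.conj_ofReal, map_natCast, map_inv₀, map_pow,
      ← Circle.coe_inv_eq_conj, inv_inv] using h
  have hn' : 3 ≤ 2 * n + 1 := by omega
  set u := Complex.arg ((α ^ (2 * n + 1) : Circle) : ℂ) with hu
  have hU : Circle.exp u = α ^ (2 * n + 1) := Circle.exp_arg _
  obtain ⟨t, ht1, ht2⟩ := exists_angle (2 * n + 1) hn' (Complex.arg_nonneg_iff.2 him)
    (Complex.arg_le_pi _) hs hs'
  rw [← hu] at ht1 ht2
  set c := s * (((2 * n + 1 : ℕ) - 1) * Real.cos t + Real.cos (u + t)) -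
    Real.cos (u + (2 * n + 1 : ℕ) * t) with hc
  have hcE : (s : ℂ) * ((2 * n : ℕ) * Circle.exp (-t) + Circle.exp (-(u + t))) -
      Circle.exp (-(u + (2 * n + 1 : ℕ) * t)) = c := by
    have hexp : ∀ x : ℝ, (Circle.exp (-x) : ℂ) = Real.cos x - Real.sin x * Complex.I := by
      intro x
      rw [Circle.coe_exp, Complex.exp_mul_I, Complex.ofReal_neg, Complex.cos_neg, Complex.sin_neg,
        Complex.ofReal_cos, Complex.ofReal_sin]
      ring
    have ht1' := congrArg (fun x : ℝ => (x : ℂ)) ht1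
    rw [hexp, hexp, hexp, hc]
    push_cast at ht1' ⊢
    linear_combination (-Complex.I) * ht1'
  have hmem := mul_add_inv_pow_mem_unitSums hn (α * Circle.exp t) (c := c)
    (by simpa using ht2)
  convert hmem using 1
  rw [← hcE]
  simp only [Circle.exp_neg, Circle.exp_add, Circle.exp_natCast_mul, hU, Circle.coe_inv,
    Circle.coe_mul, Circle.coe_pow]
  have h1 := Circle.coe_ne_zero α
  have h2 := Circle.coe_ne_zero (Circle.exp t)
  field_simp
  ring

/-- The ray from the origin through a point of a bounded complementary component leaves that
component, hence meets the curve, so the point lies on a segment from the origin to the curve. -/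
theorem H_subset_unitSums {n : ℕ} (hn : n ≠ 0) : H (2 * n + 1) ⊆ unitSums (2 * n + 1) := by
  have hseg : ∀ w ∈ hypocycloid (2 * n + 1), ∀ s : ℝ, 0 ≤ s → s ≤ 1 →
      (s : ℂ) * w ∈ unitSums (2 * n + 1) := by
    intro w hw s hs hs'
    obtain ⟨α, rfl⟩ := mem_hypocycloid_iff.1 hw
    exact smul_curve_mem_unitSums hn α hs hs'
  rintro w (hw | ⟨hw, hb⟩)
  · simpa using hseg w hw 1 zero_le_one le_rfl
  · by_cases hw0 : w = 0
    · have h := hseg _ (mem_hypocycloid_iff.2 ⟨1, rfl⟩) 0 le_rfl zero_le_one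
      rw [hw0]
      rwa [Complex.ofReal_zero, zero_mul] at h
    · obtain ⟨t, ht, htw⟩ : ∃ t : ℝ, 1 ≤ t ∧ (t : ℂ) * w ∈ hypocycloid (2 * n + 1) := by
        by_contra! hray
        have hsub : (fun t : ℝ => (t : ℂ) * w) '' Set.Ici 1 ⊆
            connectedComponentIn (hypocycloid (2 * n + 1))ᶜ w := by
          refine IsPreconnected.subset_connectedComponentIn
            (isPreconnected_Ici.image _ (by fun_prop)) ⟨1, by simp, by simp⟩ ?_
          rintro _ ⟨t, ht, rfl⟩
          exact hray t ht
        obtain ⟨R, hR⟩ := (hb.subset hsub).exists_norm_le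
        have hw' : 0 < ‖w‖ := norm_pos_iff.2 hw0
        have h := hR _ ⟨max 1 ((R + 1) / ‖w‖), Set.mem_Ici.2 (le_max_left _ _), rfl⟩
        rw [norm_mul, Complex.norm_real, Real.norm_eq_abs] at h
        have h2 : R + 1 ≤ |max 1 ((R + 1) / ‖w‖)| * ‖w‖ := by
          rw [← div_le_iff₀ hw']
          exact (le_max_right _ _).trans (le_abs_self _)
        linarith
      have h := hseg _ htw t⁻¹ (by positivity) (inv_le_one_of_one_le₀ ht)
      have ht0 : (t : ℂ) ≠ 0 := by
        rw [Complex.ofReal_ne_zero]; positivity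
      rwa [Complex.ofReal_inv, inv_mul_cancel_left₀ ht0] at h

/-! ### Interior points of the set of sums -/

/-- Converse of `exists_circle_pair`; distinct summands give `|c| < 2`. -/
theorem exists_midpoint_direction (a b : Circle) :
    ∃ (u : Circle) (c : ℝ), u ^ 2 = a * b ∧ (a : ℂ) + b = c * u ∧ (a ≠ b → |c| < 2) := by
  have ha := Circle.exp_arg a
  have hb := Circle.exp_arg b
  set x := Complex.arg a
  set y := Complex.arg b
  have hsum : (a : ℂ) + b = ((2 * Real.cos ((x - y) / 2) : ℝ) : ℂ) * Circle.exp ((x + y) / 2) := by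
    have h1 : x = (x + y) / 2 + (x - y) / 2 := by ring
    have h2 : y = (x + y) / 2 + -((x - y) / 2) := by ring
    have h3 : Circle.exp x = Circle.exp ((x + y) / 2) * Circle.exp ((x - y) / 2) := by
      rw [← Circle.exp_add, ← h1]
    have h4 : Circle.exp y = Circle.exp ((x + y) / 2) * Circle.exp (-((x - y) / 2)) := by
      rw [← Circle.exp_add, ← h2]
    rw [← ha, ← hb, h3, h4, Circle.coe_mul, Circle.coe_mul, ← mul_add,
      Circle.coe_exp, Circle.coe_exp _, Circle.coe_exp _, Complex.ofReal_neg, ← Complex.two_cos]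
    push_cast; ring
  refine ⟨Circle.exp ((x + y) / 2), 2 * Real.cos ((x - y) / 2), ?_, hsum, fun hab => ?_⟩
  · rw [← Circle.exp_natCast_mul, ← ha, ← hb, ← Circle.exp_add]
    congr 1; push_cast; ring
  · have hn := congrArg norm hsum
    rw [norm_mul, Circle.norm_coe, mul_one, Complex.norm_real, Real.norm_eq_abs] at hn
    have hpar := parallelogram_law_with_norm ℝ (a : ℂ) b
    rw [Circle.norm_coe, Circle.norm_coe] at hpar
    have hpos : 0 < ‖(a : ℂ) - b‖ := norm_pos_iff.2 (sub_ne_zero.2 fun h => hab (Circle.ext h))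
    rw [← hn]
    nlinarith [norm_nonneg ((a : ℂ) + b)]

/-- Cramer's rule in the plane: the coordinates of `w` in the real basis `u, v`. -/
theorem eq_add_of_im_mul_conj_ne_zero {u v : ℂ} (huv : (u * starRingEnd ℂ v).im ≠ 0) (w : ℂ) :
    (((w * starRingEnd ℂ v).im / (u * starRingEnd ℂ v).im : ℝ) : ℂ) * u +
      ((-(w * starRingEnd ℂ u).im / (u * starRingEnd ℂ v).im : ℝ) : ℂ) * v = w := by
  have hD : (u * starRingEnd ℂ v).im = u.im * v.re - u.re * v.im := by
    rw [Complex.mul_im, Complex.conj_re, Complex.conj_im]; ring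
  apply Complex.ext
  · rw [Complex.add_re, Complex.re_ofReal_mul, Complex.re_ofReal_mul]
    rw [div_mul_eq_mul_div, div_mul_eq_mul_div, ← add_div, div_eq_iff huv, hD,
      Complex.mul_im, Complex.mul_im, Complex.conj_re, Complex.conj_im, Complex.conj_re,
      Complex.conj_im]
    ring
  · rw [Complex.add_im, Complex.im_ofReal_mul, Complex.im_ofReal_mul]
    rw [div_mul_eq_mul_div, div_mul_eq_mul_div, ← add_div, div_eq_iff huv, hD,
      Complex.mul_im, Complex.mul_im, Complex.conj_re, Complex.conj_im, Complex.conj_re,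
      Complex.conj_im]
    ring

theorem unitSums_mem_nhds_of_independent {u v : Circle}
    (huv : ((u : ℂ) * starRingEnd ℂ v).im ≠ 0) {c d : ℝ} (hc : |c| < 2) (hd : |d| < 2)
    {t : Multiset Circle} (hp : u ^ 2 * v ^ 2 * t.prod = 1) :
    unitSums (t.card + 4) ∈ nhds ((c : ℂ) * u + d * v + (t.map Circle.coeHom).sum) := by
  set R := (t.map Circle.coeHom).sum with hR
  set D := ((u : ℂ) * starRingEnd ℂ v).im with hD
  have hD' : D = (u : ℂ).im * (v : ℂ).re - (u : ℂ).re * (v : ℂ).im := by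
    rw [hD, Complex.mul_im, Complex.conj_re, Complex.conj_im]; ring
  -- the coordinates of `w - R` in the real basis `u, v` of the plane, by Cramer's rule
  set C : ℂ → ℝ := fun w => ((w - R) * starRingEnd ℂ v).im / D with hC
  set E : ℂ → ℝ := fun w => -((w - R) * starRingEnd ℂ u).im / D with hE
  have hcont : Continuous C ∧ Continuous E := by
    constructor <;> · simp only [hC, hE]; fun_prop
  have hC0 : C (c * u + d * v + R) = c := by
    simp only [hC, add_sub_cancel_right]
    rw [div_eq_iff huv, hD']; simp; ring
  have hE0 : E (c * u + d * v + R) = d := by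
    simp only [hE, add_sub_cancel_right]
    rw [div_eq_iff huv, hD']; simp; ring
  have hCE : ∀ w, (C w : ℂ) * u + E w * v + R = w := by
    intro w
    have h : (C w : ℂ) * u + E w * v = w - R := by
      exact eq_add_of_im_mul_conj_ne_zero huv (w - R)
    rw [h, sub_add_cancel]
  have h1 : ∀ᶠ w in nhds (c * u + d * v + R), |C w| < 2 :=
    (hcont.1.abs.tendsto _).eventually_lt_const (by rwa [hC0])
  have h2 : ∀ᶠ w in nhds (c * u + d * v + R), |E w| < 2 :=
    (hcont.2.abs.tendsto _).eventually_lt_const (by rwa [hE0])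
  filter_upwards [h1, h2] with w hw1 hw2
  obtain ⟨a, b, hab, hab'⟩ := exists_circle_pair u hw1.le
  obtain ⟨a', b', hcd, hcd'⟩ := exists_circle_pair v hw2.le
  refine ⟨a ::ₘ b ::ₘ a' ::ₘ b' ::ₘ t, by simp, ?_, ?_⟩
  · simp only [Multiset.prod_cons]
    rw [← hp, ← hab, ← hcd]; simp only [mul_assoc]
  · simp only [Multiset.map_cons, Multiset.sum_cons, coeHom_eq]
    rw [← hCE w, ← hab', ← hcd']; ring

/-- A sum with two disjoint pairs of distinct summands is an interior point. Each pair sums to a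
real multiple of a unit vector, and if the two unit vectors are parallel they are first rotated
slightly in opposite senses. -/
theorem unitSums_mem_nhds_of_two_pairs {a b a' b' : Circle} (hab : a ≠ b) (hab' : a' ≠ b')
    {t : Multiset Circle} (hp : (a ::ₘ b ::ₘ a' ::ₘ b' ::ₘ t).prod = 1) :
    unitSums (t.card + 4) ∈ nhds ((a ::ₘ b ::ₘ a' ::ₘ b' ::ₘ t).map Circle.coeHom).sum := by
  obtain ⟨u, c, hu, hc, hc2⟩ := exists_midpoint_direction a b
  obtain ⟨v, d, hv, hd, hd2⟩ := exists_midpoint_direction a' b'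
  specialize hc2 hab
  specialize hd2 hab'
  have hp' : u ^ 2 * v ^ 2 * t.prod = 1 := by
    rw [hu, hv, ← hp]; simp only [Multiset.prod_cons, mul_assoc]
  have hs : ((a ::ₘ b ::ₘ a' ::ₘ b' ::ₘ t).map Circle.coeHom).sum =
      c * u + d * v + (t.map Circle.coeHom).sum := by
    simp only [Multiset.map_cons, Multiset.sum_cons, coeHom_eq]
    rw [← hc, ← hd]; ring
  rw [hs]
  by_cases huv : ((u : ℂ) * starRingEnd ℂ v).im = 0
  · obtain ⟨d', hd', hdv, hv2⟩ : ∃ d' : ℝ, |d'| < 2 ∧ (d : ℂ) * v = d' * u ∧ v ^ 2 = u ^ 2 := by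
      set x := ((u : ℂ) * starRingEnd ℂ v).re with hx
      have hux : (u : ℂ) = x * v := by
        have h : (u : ℂ) * starRingEnd ℂ v = x := by
          apply Complex.ext <;> simp [huv, hx]
        rw [← h, ← Circle.coe_inv_eq_conj, Circle.coe_inv,
          inv_mul_cancel_right₀ (Circle.coe_ne_zero v)]
      have hx1 : |x| = 1 := by
        have := congrArg norm hux
        rwa [norm_mul, Circle.norm_coe, Circle.norm_coe, mul_one, Complex.norm_real,
          Real.norm_eq_abs, eq_comm] at this
      have hxx : x * x = 1 := by rw [← abs_mul_abs_self, hx1, one_mul]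
      have hxx' : (x : ℂ) * x = 1 := by exact_mod_cast hxx
      refine ⟨d * x, by rwa [abs_mul, hx1, mul_one], ?_, ?_⟩
      · rw [hux]; push_cast; linear_combination (-(d : ℂ) * v) * hxx'
      · apply Circle.ext
        rw [Circle.coe_pow, Circle.coe_pow, hux]; linear_combination (-(v : ℂ) ^ 2) * hxx'
    -- parallel directions are rotated apart by `ε` in opposite senses, which keeps the product
    set k := |c + d'| / 4 with hk
    have hk0 : 0 ≤ k := by positivity
    have hk1 : k < 1 := by
      have := abs_add_le c d'
      rw [hk]; linarith
    -- `cos ε = (1 + k) / 2 > k` keeps the new coefficient `(c + d') / (2 cos ε)` below `2`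
    have hcos : Real.cos (Real.arccos ((1 + k) / 2)) = (1 + k) / 2 :=
      Real.cos_arccos (by linarith) (by linarith)
    have hsin : 0 < Real.sin (Real.arccos ((1 + k) / 2)) := by
      rw [Real.sin_arccos]; apply Real.sqrt_pos.2; nlinarith
    set ε := Real.arccos ((1 + k) / 2)
    have hlt : |(c + d') / (2 * Real.cos ε)| < 2 := by
      rw [hcos, abs_div, abs_of_pos (by linarith : 0 < 2 * ((1 + k) / 2)),
        div_lt_iff₀ (by linarith)]
      have : |c + d'| = 4 * k := by rw [hk]; ring
      rw [this]; linarith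
    have hcε : Real.cos ε ≠ 0 := by rw [hcos]; positivity
    have hne : (((u * Circle.exp ε : Circle) : ℂ) *
        starRingEnd ℂ ((u * Circle.exp (-ε) : Circle) : ℂ)).im ≠ 0 := by
      have h : ((u * Circle.exp ε : Circle) : ℂ) *
          starRingEnd ℂ ((u * Circle.exp (-ε) : Circle) : ℂ) = Circle.exp (2 * ε) := by
        rw [← Circle.coe_inv_eq_conj, ← Circle.coe_mul]
        congr 1
        rw [two_mul, Circle.exp_add, Circle.exp_neg, mul_inv, inv_inv, mul_mul_mul_comm,
          mul_inv_cancel, one_mul]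
      rw [h, Circle.coe_exp, Complex.exp_ofReal_mul_I_im, Real.sin_two_mul]
      exact mul_ne_zero (mul_ne_zero two_ne_zero hsin.ne') hcε
    have hpε : (u * Circle.exp ε) ^ 2 * (u * Circle.exp (-ε)) ^ 2 * t.prod = 1 := by
      rw [← hp', hv2, Circle.exp_neg, ← mul_pow, ← mul_pow, mul_mul_mul_comm, mul_inv_cancel,
        mul_one]
    convert unitSums_mem_nhds_of_independent hne hlt hlt hpε using 3
    have h2 : (Circle.exp ε : ℂ) + Circle.exp (-ε) = 2 * Real.cos ε := by
      rw [Circle.coe_exp, Circle.coe_exp, Complex.ofReal_neg, ← Complex.two_cos,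
        Complex.ofReal_cos]
    have hcε' : (Real.cos ε : ℂ) ≠ 0 := by exact_mod_cast hcε
    rw [← mul_add, Circle.coe_mul, Circle.coe_mul, ← mul_add, h2, hdv, Complex.ofReal_div]
    push_cast at hcε' ⊢
    field_simp
  · exact unitSums_mem_nhds_of_independent huv hc2 hd2 hp'

theorem eq_cons_cons_ne_or_eq_replicate {α : Type*} (t : Multiset α) [Nonempty α] :
    (∃ c d t', t = c ::ₘ d ::ₘ t' ∧ c ≠ d) ∨ ∃ a, t = Multiset.replicate t.card a := by
  rcases t.empty_or_exists_mem with rfl | ⟨a, ha⟩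
  · exact Or.inr ⟨Classical.arbitrary α, by simp⟩
  · by_cases h : ∀ b ∈ t, b = a
    · exact Or.inr ⟨a, Multiset.eq_replicate_card.2 h⟩
    · push Not at h
      obtain ⟨b, hb, hba⟩ := h
      obtain ⟨t1, rfl⟩ := Multiset.exists_cons_of_mem ha
      obtain ⟨t2, rfl⟩ := Multiset.exists_cons_of_mem ((Multiset.mem_cons.1 hb).resolve_left hba)
      exact Or.inl ⟨a, b, t2, rfl, hba.symm⟩

/-- Three distinct points of the circle are not collinear. -/
theorem im_mul_conj_ne_zero_of_ne {a b c : Circle} (hab : a ≠ b) (hac : a ≠ c) (hbc : b ≠ c) :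
    (((a : ℂ) - c) * starRingEnd ℂ ((b : ℂ) - c)).im ≠ 0 := by
  intro h
  have hq : (b : ℂ) - c ≠ 0 := sub_ne_zero.2 fun h => hbc (Circle.ext h)
  set q := (b : ℂ) - c with hq'
  obtain ⟨l, hl⟩ : ∃ l : ℝ, (a : ℂ) - c = l * q := by
    refine ⟨((((a : ℂ) - c) * starRingEnd ℂ q).re) / Complex.normSq q, ?_⟩
    have h1 : ((a : ℂ) - c) * starRingEnd ℂ q = ((((a : ℂ) - c) * starRingEnd ℂ q).re : ℝ) := by
      apply Complex.ext <;> simp [h]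
    have h2 : (Complex.normSq q : ℂ) ≠ 0 := by
      exact_mod_cast (Complex.normSq_pos.2 hq).ne'
    push_cast
    rw [← h1, div_mul_eq_mul_div, eq_div_iff h2, Complex.normSq_eq_conj_mul_self, mul_assoc]
  have ha : Complex.normSq (c + l * q) = 1 := by
    rw [← hl, add_sub_cancel, Circle.normSq_coe]
  have hb : Complex.normSq (c + q) = 1 := by
    rw [hq', add_sub_cancel, Circle.normSq_coe]
  have hc := Circle.normSq_coe c
  have hpos := Complex.normSq_pos.2 hq
  rw [Complex.normSq_add] at ha hb
  simp only [map_mul, Complex.conj_ofReal, Complex.normSq_ofReal] at ha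
  rw [show (c : ℂ) * (l * starRingEnd ℂ q) = l * (c * starRingEnd ℂ q) by ring,
    Complex.re_ofReal_mul] at ha
  -- a line through `c` meets the circle only for the parameters `0` and `1`
  have h3 : Complex.normSq q * (l * (l - 1)) = 0 := by
    linear_combination ha - l * hb - (1 - l) * hc
  rcases mul_eq_zero.1 ((mul_eq_zero.1 h3).resolve_left hpos.ne') with h4 | h4
  · rw [h4, Complex.ofReal_zero, zero_mul, sub_eq_zero] at hl
    exact hac (Circle.ext hl)
  · rw [sub_eq_zero.1 h4, Complex.ofReal_one, one_mul, hq', sub_left_inj] at hl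
    exact hab (Circle.ext hl)

/-- The map `(x, y) ↦ a exp (i x) + b exp (i y) + c exp (-i (x + y))` has at the origin the
derivative `(x, y) ↦ i (x (a - c) + y (b - c))`, which is onto since `a, b, c` are not collinear. -/
theorem unitSums_three_mem_nhds {a b c : Circle} (hab : a ≠ b) (hac : a ≠ c) (hbc : b ≠ c)
    (hp : a * b * c = 1) : unitSums 3 ∈ nhds ((a : ℂ) + b + c) := by
  set f : ℝ × ℝ → ℂ := fun p =>
    a * Complex.exp (p.1 * Complex.I) + b * Complex.exp (p.2 * Complex.I) +
      c * Complex.exp (-(p.1 + p.2) * Complex.I) with hf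
  have hmem : ∀ p, f p ∈ unitSums 3 := by
    intro p
    refine ⟨{a * Circle.exp p.1, b * Circle.exp p.2, c * Circle.exp (-(p.1 + p.2))}, rfl, ?_, ?_⟩
    · simp only [Multiset.insert_eq_cons, Multiset.prod_cons, Multiset.prod_singleton,
        Circle.exp_neg, Circle.exp_add]
      rw [← hp, mul_inv]
      calc _ = a * b * c * (Circle.exp p.1 * (Circle.exp p.1)⁻¹) *
            (Circle.exp p.2 * (Circle.exp p.2)⁻¹) := by
            simp only [mul_assoc, mul_comm, mul_left_comm]
        _ = _ := by simp
    · simp only [Multiset.insert_eq_cons, Multiset.map_cons, Multiset.map_singleton,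
        Multiset.sum_cons, Multiset.sum_singleton, coeHom_eq, Circle.coe_mul, Circle.coe_exp, hf]
      push_cast; ring
  set L₁ : ℝ × ℝ →L[ℝ] ℂ := Complex.ofRealCLM ∘L ContinuousLinearMap.fst ℝ ℝ ℝ
  set L₂ : ℝ × ℝ →L[ℝ] ℂ := Complex.ofRealCLM ∘L ContinuousLinearMap.snd ℝ ℝ ℝ
  have h₁ := ((L₁.hasStrictFDerivAt (x := (0, 0))).mul_const Complex.I).cexp.const_mul (a : ℂ)
  have h₂ := ((L₂.hasStrictFDerivAt (x := (0, 0))).mul_const Complex.I).cexp.const_mul (b : ℂ)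
  have h₃ :=
    (((L₁ + L₂).hasStrictFDerivAt (x := (0, 0))).neg.mul_const Complex.I).cexp.const_mul (c : ℂ)
  have hderiv := (h₁.add h₂).add h₃
  have hnc := im_mul_conj_ne_zero_of_ne hab hac hbc
  have hnhds := hderiv.map_nhds_eq_of_surj (LinearMap.range_eq_top.2 fun w => by
    refine ⟨(((w * -Complex.I) * starRingEnd ℂ ((b : ℂ) - c)).im /
      (((a : ℂ) - c) * starRingEnd ℂ ((b : ℂ) - c)).im,
      -((w * -Complex.I) * starRingEnd ℂ ((a : ℂ) - c)).im /
      (((a : ℂ) - c) * starRingEnd ℂ ((b : ℂ) - c)).im), ?_⟩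
    have h := eq_add_of_im_mul_conj_ne_zero hnc (w * -Complex.I)
    generalize ((w * -Complex.I) * starRingEnd ℂ ((b : ℂ) - c)).im /
      (((a : ℂ) - c) * starRingEnd ℂ ((b : ℂ) - c)).im = x at h ⊢
    generalize -((w * -Complex.I) * starRingEnd ℂ ((a : ℂ) - c)).im /
      (((a : ℂ) - c) * starRingEnd ℂ ((b : ℂ) - c)).im = y at h ⊢
    simp [L₁, L₂]
    linear_combination Complex.I * h - w * Complex.I_sq)
  have h0 : f (0, 0) = a + b + c := by simp [hf]
  have hfeq : (nhds ((0 : ℝ), (0 : ℝ))).map f = nhds ((a : ℂ) + b + c) := by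
    rw [← h0]; exact hnhds
  rw [← hfeq]
  exact Filter.mem_map.2 (Filter.univ_mem' hmem)

/-! ### The region bounded by the hypocycloid is the set of sums -/

theorem exists_fin_map_eq {α : Type*} {s : Multiset α} {n : ℕ} (hs : s.card = n) :
    ∃ z : Fin n → α, Finset.univ.val.map z = s := by
  subst hs
  obtain ⟨l, rfl⟩ := Quot.exists_rep s
  exact ⟨l.get, (Fin.univ_val_map _).trans (congrArg _ (List.ofFn_get l))⟩

/-- One summand is determined by the others, which are arbitrary. -/
theorem mem_unitSums_succ_iff {n : ℕ} {w : ℂ} : w ∈ unitSums (n + 1) ↔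
    ∃ z : Fin n → Circle, ∑ i, (z i : ℂ) + ((∏ i, z i)⁻¹ : Circle) = w := by
  constructor
  · rintro ⟨s, hs, hp, rfl⟩
    obtain ⟨a, ha⟩ := Multiset.card_pos_iff_exists_mem.1 (show 0 < s.card by omega)
    obtain ⟨t, rfl⟩ := Multiset.exists_cons_of_mem ha
    obtain ⟨z, hz⟩ := exists_fin_map_eq (n := n) (show t.card = n by simpa using hs)
    refine ⟨z, ?_⟩
    have hprod : ∏ i, z i = t.prod := by rw [← hz]; rfl
    have ha : a = (∏ i, z i)⁻¹ := by
      rw [hprod]; exact eq_inv_of_mul_eq_one_left (by simpa using hp)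
    have hsum : ∑ i, (z i : ℂ) = (t.map Circle.coeHom).sum := by
      rw [← hz, Multiset.map_map]; rfl
    rw [hsum, ← ha, Multiset.map_cons, Multiset.sum_cons, coeHom_eq, add_comm]
  · rintro ⟨z, rfl⟩
    refine ⟨(∏ i, z i)⁻¹ ::ₘ Finset.univ.val.map z, by simp, ?_, ?_⟩
    · rw [Multiset.prod_cons]; exact inv_mul_cancel _
    · rw [Multiset.map_cons, Multiset.sum_cons, Multiset.map_map, add_comm]; rfl

theorem isCompact_unitSums (n : ℕ) : IsCompact (unitSums (n + 1)) := by
  have h : unitSums (n + 1) = Set.range fun z : Fin n → Circle =>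
      ∑ i, (z i : ℂ) + ((∏ i, z i)⁻¹ : Circle) := by
    ext w; exact mem_unitSums_succ_iff
  rw [h]
  have hcoe : Continuous fun z : Circle => (z : ℂ) := continuous_subtype_val
  refine isCompact_range (Continuous.add (continuous_finsetSum _ fun i _ => ?_) ?_)
  · exact hcoe.comp (continuous_apply i)
  · exact hcoe.comp (continuous_finsetProd _ fun i _ => continuous_apply i).inv

theorem cons_replicate_mem_hypocycloid {n : ℕ} {a b : Circle}
    (hp : (a ::ₘ Multiset.replicate n b).prod = 1) :
    ((a ::ₘ Multiset.replicate n b).map Circle.coeHom).sum ∈ hypocycloid (n + 1) := by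
  refine mem_hypocycloid_iff.2 ⟨b, ?_⟩
  rw [Multiset.prod_cons, Multiset.prod_replicate] at hp
  rw [eq_inv_of_mul_eq_one_left hp]
  simp [coeHom_eq, add_comm]

/-- A point of `unitSums (n + 1)` off the hypocycloid is an interior point: if no two disjoint
pairs of distinct summands exist, then either `n` summands are equal or there are just three
summands and they are distinct. -/
theorem mem_hypocycloid_or_mem_nhds {n : ℕ} (hn : 2 ≤ n) {w : ℂ} (hw : w ∈ unitSums (n + 1)) :
    w ∈ hypocycloid (n + 1) ∨ unitSums (n + 1) ∈ nhds w := by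
  obtain ⟨s, hs, hp, rfl⟩ := hw
  rcases eq_cons_cons_ne_or_eq_replicate s with ⟨a, b, t, rfl, hab⟩ | ⟨a, ha⟩
  · obtain rfl : t.card + 1 = n := by simpa using hs
    rcases eq_cons_cons_ne_or_eq_replicate t with ⟨c, d, t, rfl, hcd⟩ | ⟨c, hc⟩
    · right
      simpa using unitSums_mem_nhds_of_two_pairs hab hcd hp
    · by_cases hac : c = a
      · left
        rw [hac] at hc
        have h : a ::ₘ b ::ₘ t = b ::ₘ Multiset.replicate (t.card + 1) a := by
          rw [Multiset.replicate_succ, ← hc, Multiset.cons_swap]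
        rw [h] at hp ⊢
        exact cons_replicate_mem_hypocycloid hp
      by_cases hbc : c = b
      · left
        rw [hbc] at hc
        have h : a ::ₘ b ::ₘ t = a ::ₘ Multiset.replicate (t.card + 1) b := by
          rw [Multiset.replicate_succ, ← hc]
        rw [h] at hp ⊢
        exact cons_replicate_mem_hypocycloid hp
      right
      obtain ⟨k, hk⟩ : ∃ k, t.card = k + 1 := Nat.exists_eq_add_of_le' (by omega)
      rw [hk, Multiset.replicate_succ] at hc
      rcases k with _ | k
      · subst hc
        simp only [Multiset.prod_cons, Multiset.replicate_zero, Multiset.prod_zero, mul_one] at hp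
        have h := unitSums_three_mem_nhds hab (Ne.symm hac) (Ne.symm hbc)
          (by rw [← hp, mul_assoc])
        simpa [coeHom_eq, add_assoc] using h
      · rw [Multiset.replicate_succ] at hc
        subst hc
        have h : a ::ₘ b ::ₘ c ::ₘ c ::ₘ Multiset.replicate k c =
            a ::ₘ c ::ₘ b ::ₘ c ::ₘ Multiset.replicate k c := by
          rw [Multiset.cons_swap b c]
        rw [h] at hp ⊢
        simpa using unitSums_mem_nhds_of_two_pairs (Ne.symm hac) (Ne.symm hbc) hp
  · left
    rw [hs, Multiset.replicate_succ] at ha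
    subst ha
    exact cons_replicate_mem_hypocycloid hp

/-- A component of the complement of the curve that meets `unitSums (n + 1)` stays inside it,
because it cannot cross the frontier; hence it is bounded. -/
theorem unitSums_subset_H {n : ℕ} (hn : 2 ≤ n) : unitSums (n + 1) ⊆ H (n + 1) := by
  intro w hw
  by_cases hwΓ : w ∈ hypocycloid (n + 1)
  · exact Or.inl hwΓ
  refine Or.inr ⟨hwΓ, (isCompact_unitSums n).isBounded.subset ?_⟩
  have hint : unitSums (n + 1) ∩ (hypocycloid (n + 1))ᶜ ⊆ interior (unitSums (n + 1)) :=
    fun v hv => mem_interior_iff_mem_nhds.2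
      ((mem_hypocycloid_or_mem_nhds hn hv.1).resolve_left hv.2)
  refine (IsPreconnected.subset_left_of_subset_union isOpen_interior
    (isCompact_unitSums n).isClosed.isOpen_compl
    (disjoint_compl_right.mono_left interior_subset) ?_
    ⟨w, mem_connectedComponentIn hwΓ, hint ⟨hw, hwΓ⟩⟩ isPreconnected_connectedComponentIn).trans
    interior_subset
  intro v hv
  by_cases hvT : v ∈ unitSums (n + 1)
  · exact Or.inl (hint ⟨hvT, connectedComponentIn_subset _ _ hv⟩)
  · exact Or.inr hvT

theorem H_eq_unitSums {n : ℕ} (hn : n ≠ 0) : H (2 * n + 1) = unitSums (2 * n + 1) :=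
  (H_subset_unitSums hn).antisymm (unitSums_subset_H (by omega))

/-! ### The Laurent polynomial of a prime power -/

open Polynomial

theorem c_of_lt_totient {d j k : ℕ} (hk : k < d.totient) : c d j k = if j = k then 1 else 0 := by
  rw [c, (modByMonic_eq_self_iff (cyclotomic.monic d ℤ)).2, coeff_X_pow]
  rw [degree_X_pow, degree_cyclotomic]
  exact_mod_cast hk

/-- With `r = n + 1` prime and `m = r ^ b`, the identity `Φ(x) = ∑_{q ≤ n} x ^ (m q)` for the
`r ^ (b + 1)`-th cyclotomic polynomial gives `x ^ (m n + s) ≡ -∑_{q < n} x ^ (s + m q)`. -/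
theorem c_prime_pow_top {n b i q s : ℕ} (hr : (n + 1).Prime) (hi : i < (n + 1) ^ b) (hq : q < n)
    (hs : s < (n + 1) ^ b) :
    c ((n + 1) ^ (b + 1)) (i + (n + 1) ^ b * q) (((n + 1) ^ (b + 1)).totient + s) =
      if i = s then -1 else 0 := by
  have : Fact (n + 1).Prime := ⟨hr⟩
  set m := (n + 1) ^ b with hm
  have hm0 : 0 < m := by positivity
  have hmonic := cyclotomic.monic ((n + 1) ^ (b + 1)) ℤ
  have htot : ((n + 1) ^ (b + 1)).totient = m * n := by
    rw [Nat.totient_prime_pow_succ hr, Nat.add_sub_cancel]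
  have hcoeff : ∀ j, (-∑ p ∈ Finset.range n, (X : ℤ[X]) ^ (s + m * p)).coeff j =
      -∑ p ∈ Finset.range n, if j = s + m * p then 1 else 0 := by
    intro j
    simp only [coeff_neg, finsetSum_coeff, coeff_X_pow]
  have hmod : (X ^ (((n + 1) ^ (b + 1)).totient + s) : ℤ[X]) %ₘ cyclotomic ((n + 1) ^ (b + 1)) ℤ =
      -∑ p ∈ Finset.range n, X ^ (s + m * p) := by
    refine (div_modByMonic_unique (X ^ s) _ hmonic ⟨?_, ?_⟩).2
    · rw [cyclotomic_prime_pow_eq_geom_sum hr, ← hm, Finset.sum_range_succ, add_mul, Finset.sum_mul]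
      have : ∀ p, ((X : ℤ[X]) ^ m) ^ p * X ^ s = X ^ (s + m * p) := fun p => by
        rw [← pow_mul, ← pow_add, add_comm]
      simp only [this]
      rw [neg_add_cancel_left]
      rw [htot, add_comm]
    · rw [degree_cyclotomic, htot, degree_lt_iff_coeff_zero]
      intro j hj
      rw [hcoeff, neg_eq_zero]
      refine Finset.sum_eq_zero fun p hp => if_neg ?_
      have hp' : p + 1 ≤ n := Finset.mem_range.1 hp
      have := Nat.mul_le_mul_left m hp'
      rw [mul_add] at this
      omega
  rw [c, hmod, hcoeff]
  have hiff : ∀ p, i + m * q = s + m * p ↔ q = p ∧ i = s := by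
    refine fun p => ⟨fun h => ?_, fun ⟨h1, h2⟩ => by rw [h1, h2]⟩
    have h1 : i = s := by
      have := congrArg (· % m) h
      simpa [Nat.mod_eq_of_lt hi, Nat.mod_eq_of_lt hs] using this
    refine ⟨?_, h1⟩
    rw [h1] at h
    exact Nat.eq_of_mul_eq_mul_left hm0 (Nat.add_left_cancel h)
  simp only [hiff]
  by_cases h : i = s
  · simp [h, hq]
  · simp [h]

/-- The variables are grouped by the residue of their index modulo `(n + 1) ^ b`; the Laurent
polynomial is a sum over these groups. -/
theorem g_prime_pow {n b : ℕ} (hr : (n + 1).Prime)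
    (E : Fin n × Fin ((n + 1) ^ b) ≃ Fin ((n + 1) ^ (b + 1)).totient)
    (hE : ∀ q s, (E (q, s) : ℕ) = s + (n + 1) ^ b * q)
    (z : Fin ((n + 1) ^ (b + 1)).totient → Circle) :
    g ((n + 1) ^ (b + 1)) z =
      ∑ s, (∑ q, (z (E (q, s)) : ℂ) + ((∏ q, z (E (q, s)))⁻¹ : Circle)) := by
  have htot : ((n + 1) ^ (b + 1)).totient = (n + 1) ^ b * n := by
    rw [Nat.totient_prime_pow_succ hr, Nat.add_sub_cancel]
  have hd : Finset.range ((n + 1) ^ (b + 1)) =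
      Finset.range (((n + 1) ^ (b + 1)).totient + (n + 1) ^ b) := by
    rw [htot, pow_succ, mul_add_one]
  rw [g, hd, Finset.sum_range_add, Finset.sum_add_distrib]
  congr 1
  · rw [Finset.sum_range]
    have h : ∀ k : Fin ((n + 1) ^ (b + 1)).totient,
        ∏ j, (z j : ℂ) ^ c ((n + 1) ^ (b + 1)) j k = z k := by
      intro k
      rw [Finset.prod_eq_single k]
      · rw [c_of_lt_totient k.2, if_pos rfl, zpow_one]
      · intro j _ hj
        rw [c_of_lt_totient k.2, if_neg (fun h => hj (Fin.ext h)), zpow_zero]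
      · simp
    rw [Finset.sum_congr rfl fun k _ => h k, ← E.sum_comp, Fintype.sum_prod_type_right]
  · rw [Finset.sum_range]
    refine Finset.sum_congr rfl fun s _ => ?_
    rw [← E.prod_comp, Fintype.prod_prod_type_right, Finset.prod_eq_single s]
    · rw [← Finset.prod_inv_distrib, ← coeHom_eq, map_prod]
      refine Finset.prod_congr rfl fun q _ => ?_
      rw [hE, c_prime_pow_top hr s.2 q.2 s.2, if_pos rfl, zpow_neg_one]
      rfl
    · intro i _ hi
      refine Finset.prod_eq_one fun q _ => ?_
      rw [hE, c_prime_pow_top hr i.2 q.2 s.2, if_neg (fun h => hi (Fin.ext h)),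
        zpow_zero]
    · simp

theorem range_g_prime_pow {n b : ℕ} (hr : (n + 1).Prime) :
    Set.range (g ((n + 1) ^ (b + 1))) = ∑ _s : Fin ((n + 1) ^ b), unitSums (n + 1) := by
  have htot : n * (n + 1) ^ b = ((n + 1) ^ (b + 1)).totient := by
    rw [Nat.totient_prime_pow_succ hr, Nat.add_sub_cancel, mul_comm]
  set E := (finProdFinEquiv (m := n) (n := (n + 1) ^ b)).trans (finCongr htot) with hEdef
  have hE : ∀ q s, (E (q, s) : ℕ) = s + (n + 1) ^ b * q := fun _ _ => rfl
  ext w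
  rw [Set.mem_finsetSum]
  constructor
  · rintro ⟨z, rfl⟩
    exact ⟨_, fun {s} _ => mem_unitSums_succ_iff.2 ⟨fun q => z (E (q, s)), rfl⟩,
      (g_prime_pow hr E hE z).symm⟩
  · rintro ⟨f, hf, rfl⟩
    choose Z hZ using fun s => mem_unitSums_succ_iff.1 (hf (Finset.mem_univ s))
    refine ⟨fun j => Z (E.symm j).2 (E.symm j).1, ?_⟩
    rw [g_prime_pow hr E hE]
    refine Finset.sum_congr rfl fun s _ => ?_
    simp only [Equiv.symm_apply_apply]
    exact hZ s

end CyclicSupercharacter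

theorem mainTheorem4 (r b : ℕ) (hr : r.Prime) (hodd : Odd r) (hb : 1 ≤ b) :
    Set.range (CyclicSupercharacter.g (r ^ b)) =
      ∑ _j ∈ Finset.Icc 1 (r ^ (b - 1)), CyclicSupercharacter.H r := by
  obtain ⟨n, rfl⟩ := hodd
  obtain ⟨b, rfl⟩ := Nat.exists_eq_add_of_le' hb
  have hn : n ≠ 0 := by
    rintro rfl
    exact Nat.not_prime_one hr
  rw [CyclicSupercharacter.range_g_prime_pow hr, CyclicSupercharacter.H_eq_unitSums hn]
  simp only [Finset.sum_const, Finset.card_univ, Fintype.card_fin, Nat.card_Icc,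
    Nat.add_sub_cancel]
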